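/- Let $p$ be a prime number (in particular, any prime $p\equiv 1 \pmod 8$), and let $E$ be the congruent number elliptic curve $y^2=x^3-p^2x$ over $\mathbb{Q}$. Say that $p$ is $\alpha^{\pm}$-Pythagorean if there are integers $a,b,c$ with $\gcd(a,b,c)=1$ such that $pc^2=a^2+b^2$ and at least one of the integers $(a-2b)^2+b^2$ and $(a+2b)^2+b^2$ is a perfect square. Say that $p$ is $\beta$-Pythagorean if there are integers $a,e,m,u$ with $\gcd(e,m)=1$ such that $pe^2m^2=2a^2-u^2$ and $pe^2=2a-m^2$. Let $\overline{E}: y^2=x^3+4p^2x$ be the curve $2$-isogenous to $E$, and let $\overline{\alpha}:\overline{E}(\mathbb{Q})\to\mathbb{Q}^*/{\mathbb{Q}^*}^2$ be the descent map that sends the point at infinity to the class of $1$, the point $(0,0)$ to the class of $4p^2$, and a point $(x,y)$ with $x\neq 0$ to the class of $x$. Then: 1. the group $E(\mathbb{Q})$ has rank exactly $2$ if and only if $p$ is both $\alpha^{\pm}$-Pythagorean and $\beta$-Pythagorean; 2. $p$ is $\alpha^{\pm}$-Pythagorean if and only if the class of $p$ lies in the image of $\overline{\alpha}$; 3. $p$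 is $\beta$-Pythagorean if and only if the class of $2$ lies in the image of $\overline{\alpha}$. -/

import Mathlib

/-- The Weierstrass curve `y² = x³ + a x² + b x` over `ℚ`. -/
def twoTorsionCurve (a b : ℚ) : WeierstrassCurve ℚ where
  a₁ := 0
  a₂ := a
  a₃ := 0
  a₄ := b
  a₆ := 0

/-- The group `ℚ* / ℚ*²`. -/
abbrev SquareClassGroup : Type :=
  ℚˣ ⧸ (powMonoidHom 2 : ℚˣ →* ℚˣ).range

/-- The class of a nonzero rational number in `ℚ* / ℚ*²`. -/
def squareClass (x : ℚ) (hx : x ≠ 0) : SquareClassGroup :=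
  QuotientGroup.mk (Units.mk0 x hx)

/-- The 2-descent map `E(ℚ) → ℚ* / ℚ*²` of `E : y² = x³ + a x² + b x` with `b ≠ 0`:
the point at infinity goes to `1`, the point `(0, 0)` to the class of `b`, and a point
`(x, y)` with `x ≠ 0` to the class of `x`. -/
def descentMap (a b : ℚ) (hb : b ≠ 0) :
    (twoTorsionCurve a b).toAffine.Point → SquareClassGroup
  | .zero => 1
  | .some x _ _ => if hx : x = 0 then squareClass b hb else squareClass x hx

/-- The congruent number curve `E : y² = x³ - n² x`. -/
def congruentCurve (n : ℕ) : WeierstrassCurve ℚ :=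
  twoTorsionCurve 0 (-(n : ℚ) ^ 2)

theorem four_mul_sq_ne_zero_of_prime {p : ℕ} (hp : p.Prime) : 4 * (p : ℚ) ^ 2 ≠ 0 :=
  mul_ne_zero four_ne_zero (pow_ne_zero 2 (Nat.cast_ne_zero.mpr hp.ne_zero))

/-- The 2-descent map of the curve `y² = x³ + 4 p² x`, which is 2-isogenous to
`y² = x³ - p² x` (the curve isogenous to `y² = x³ + a x² + b x` being
`y² = x³ - 2 a x² + (a² - 4 b) x`). -/
def isogenousDescentMap (p : ℕ) (hp : p.Prime) :
    (twoTorsionCurve 0 (4 * (p : ℚ) ^ 2)).toAffine.Point → SquareClassGroup :=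
  descentMap 0 (4 * (p : ℚ) ^ 2) (four_mul_sq_ne_zero_of_prime hp)

/-- `n c² = a² + b²` for coprime integers `a, b, c` such that `(a - 2b)² + b²` is a square. -/
def IsAlphaMinusPythagorean (n : ℕ) : Prop :=
  ∃ a b c : ℤ, Int.gcd a (Int.gcd b c) = 1 ∧ (n : ℤ) * c ^ 2 = a ^ 2 + b ^ 2 ∧
    IsSquare ((a - 2 * b) ^ 2 + b ^ 2)

/-- `n c² = a² + b²` for coprime integers `a, b, c` such that `(a + 2b)² + b²` is a square. -/
def IsAlphaPlusPythagorean (n : ℕ) : Prop :=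
  ∃ a b c : ℤ, Int.gcd a (Int.gcd b c) = 1 ∧ (n : ℤ) * c ^ 2 = a ^ 2 + b ^ 2 ∧
    IsSquare ((a + 2 * b) ^ 2 + b ^ 2)

/-- `α^±`-Pythagorean: `α^-`-Pythagorean or `α^+`-Pythagorean. -/
def IsAlphaPythagorean (n : ℕ) : Prop :=
  IsAlphaMinusPythagorean n ∨ IsAlphaPlusPythagorean n

/-- `β`-Pythagorean: there are integers `a, e, m, u` with `n e² m² = 2 a² - u²`,
`n e² = 2 a - m²` and `gcd(e, m) = 1`. -/
def IsBetaPythagorean (n : ℕ) : Prop :=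
  ∃ a e m u : ℤ, (n : ℤ) * e ^ 2 * m ^ 2 = 2 * a ^ 2 - u ^ 2 ∧
    (n : ℤ) * e ^ 2 = 2 * a - m ^ 2 ∧ Int.gcd e m = 1

/-! ### Index of `nA` in a finitely generated abelian group -/

section DoublingIndex

variable {A B : Type} [AddCommGroup A] [AddCommGroup B]

/-! The argument is a complete 2-descent on `E`. The maps `x` and `x + p` modulo squares are
homomorphisms on `E(ℚ)` whose kernels meet exactly in `2E(ℚ)`, because `x` and `x + p` being squares
forces `x - p` to be one (`ker_inf_ker_eq_range`). The image of the first is `{±1, ±p}`. The second,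
restricted to the kernel of the first, has the same image as the descent map of the isogenous curve
(`range_isogenousDescentMap`). Hence `[E : 2E] = 4 * #im`. Heights give finite generation, so also
`[E : 2E] = 2 ^ r * 4`, and the image has order `2 ^ r`.

This image lies in `{1, 2, p, 2p}`. For odd `p` these classes are distinct, so `r = 2` exactly when
`p` and `2` both occur. For `p = 2` the rank is at most `1` and the `β` condition fails 2-adically.

The class of `p` occurs iff `p N² = M⁴ + 4 e⁴` is solvable with `M e ≠ 0`; factoring the right side
as `((M + e)² + e²)((M - e)² + e²)` gives the `α` condition. The class of `2` occurs iff `2 N² = M⁴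
+ p² e⁴` is, and completing the square with `2 a = p e² + M²` gives the `β` condition. -/

theorem nsmulAddMonoidHom_range_index_of_finite [Finite A] (n : ℕ) :
    (nsmulAddMonoidHom (α := A) n).range.index = Nat.card (nsmulAddMonoidHom (α := A) n).ker := by
  have h := (nsmulAddMonoidHom (α := A) n).ker.card_mul_index
  rw [AddSubgroup.index_ker, ← (nsmulAddMonoidHom (α := A) n).range.index_mul_card] at h
  exact (Nat.eq_of_mul_eq_mul_right Nat.card_pos h).symm

theorem nsmulAddMonoidHom_range_index_of_free [Module.Free ℤ A] [Module.Finite ℤ A] (n : ℕ)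
    [NeZero n] : (nsmulAddMonoidHom (α := A) n).range.index = n ^ Module.finrank ℤ A := by
  have h : (nsmulAddMonoidHom (α := A) n).range =
      (LinearMap.range (LinearMap.lsmul ℤ A n)).toAddSubgroup := by
    ext x; simp
  rw [← ModN.natCard_eq A n, h]
  rfl

theorem nsmulAddMonoidHom_range_index_prod (n : ℕ) :
    (nsmulAddMonoidHom (α := A × B) n).range.index =
      (nsmulAddMonoidHom (α := A) n).range.index * (nsmulAddMonoidHom (α := B) n).range.index := by
  rw [← AddSubgroup.index_prod]
  congr 1
  ext ⟨x, y⟩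
  simp [AddSubgroup.mem_prod]

theorem nsmulAddMonoidHom_ker_card_prod (n : ℕ) :
    Nat.card (nsmulAddMonoidHom (α := A × B) n).ker =
      Nat.card (nsmulAddMonoidHom (α := A) n).ker *
        Nat.card (nsmulAddMonoidHom (α := B) n).ker := by
  rw [← Nat.card_prod, ← Nat.card_congr (AddSubgroup.prodEquiv _ _).toEquiv]
  congr! 2
  ext ⟨x, y⟩
  simp [AddSubgroup.mem_prod]

theorem nsmulAddMonoidHom_range_index_congr (e : A ≃+ B) (n : ℕ) :
    (nsmulAddMonoidHom (α := A) n).range.index = (nsmulAddMonoidHom (α := B) n).range.index := by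
  rw [← AddSubgroup.index_map_equiv _ e]
  congr 1
  ext x
  constructor
  · rintro ⟨_, ⟨y, rfl⟩, rfl⟩
    exact ⟨e y, by simp⟩
  · rintro ⟨y, rfl⟩
    exact ⟨n • e.symm y, ⟨e.symm y, rfl⟩, by simp⟩

theorem nsmulAddMonoidHom_ker_card_congr (e : A ≃+ B) (n : ℕ) :
    Nat.card (nsmulAddMonoidHom (α := A) n).ker = Nat.card (nsmulAddMonoidHom (α := B) n).ker :=
  Nat.card_congr (e.toEquiv.subtypeEquiv fun x => by
    simp [AddMonoidHom.mem_ker, ← map_nsmul])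

/-- For a finitely generated abelian group `A` of rank `r`, `[A : nA] = n ^ r * #A[n]`. -/
theorem exists_rank_eq_and_nsmul_range_index (A : Type) [AddCommGroup A] [AddGroup.FG A] (n : ℕ)
    [NeZero n] :
    ∃ r : ℕ, Module.rank ℤ A = r ∧ (nsmulAddMonoidHom (α := A) n).range.index =
        n ^ r * Nat.card (nsmulAddMonoidHom (α := A) n).ker := by
  classical
  obtain ⟨r, ι, _, p, hp, e, ⟨f⟩⟩ := AddCommGroup.equiv_free_prod_directSum_zmod A
  have : ∀ i, NeZero (p i ^ e i) := fun i => ⟨pow_ne_zero _ (hp i).ne_zero⟩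
  have hfin : Finite (DirectSum ι fun i => ZMod (p i ^ e i)) :=
    Finite.of_equiv _ DFinsupp.equivFunOnFintype.symm
  have hker : Nat.card (nsmulAddMonoidHom (α := Fin r →₀ ℤ) n).ker = 1 := by
    rw [AddSubgroup.card_eq_one, AddMonoidHom.ker_eq_bot_iff]
    intro x y h
    ext i
    have := DFunLike.congr_fun h i
    simpa [NeZero.ne n] using this
  refine ⟨r, ?_, ?_⟩
  · rw [f.toIntLinearEquiv.rank_eq]
    -- The projection to the free part has torsion kernel, so it preserves rank.
    have hsurj : Function.Surjective (LinearMap.fst ℤ (Fin r →₀ ℤ)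
        (DirectSum ι fun i => ZMod (p i ^ e i))) := LinearMap.fst_surjective
    rw [← rank_quotient_eq_of_le_torsion (M' := LinearMap.ker (LinearMap.fst ℤ (Fin r →₀ ℤ)
      (DirectSum ι fun i => ZMod (p i ^ e i)))),
      (LinearMap.quotKerEquivOfSurjective _ hsurj).rank_eq]
    · simp
    · rintro ⟨x, y⟩ hx
      obtain rfl : x = 0 := hx
      obtain ⟨m, hm, h⟩ := (isOfFinAddOrder_of_finite y).exists_nsmul_eq_zero
      refine ⟨⟨m, mem_nonZeroDivisors_of_ne_zero (by exact_mod_cast hm.ne')⟩, ?_⟩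
      simp [Submonoid.smul_def, Prod.ext_iff, h]
  · rw [nsmulAddMonoidHom_range_index_congr f, nsmulAddMonoidHom_ker_card_congr f,
      nsmulAddMonoidHom_range_index_prod, nsmulAddMonoidHom_ker_card_prod, hker, one_mul,
      nsmulAddMonoidHom_range_index_of_free (A := Fin r →₀ ℤ),
      nsmulAddMonoidHom_range_index_of_finite]
    simp

end DoublingIndex

/-! ### Heights and Mordell's theorem -/

section TwoTorsionCurve

open WeierstrassCurve WeierstrassCurve.Affine Height

variable {b : ℚ}

theorem twoTorsionCurve_zero_equation_iff {x y : ℚ} :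
    (twoTorsionCurve 0 b).toAffine.Equation x y ↔ y ^ 2 = x ^ 3 + b * x := by
  simp [Affine.equation_iff, twoTorsionCurve]

theorem twoTorsionCurve_zero_isElliptic (hb : b ≠ 0) : (twoTorsionCurve 0 b).IsElliptic := by
  rw [isElliptic_iff, isUnit_iff_ne_zero]
  have : (twoTorsionCurve 0 b).Δ = -64 * b ^ 3 := by
    simp [WeierstrassCurve.Δ, b₂, b₄, b₆, b₈, twoTorsionCurve]; ring
  rw [this]
  positivity

theorem twoTorsionCurve_zero_nonsingular (hb : b ≠ 0) {x y : ℚ} (h : y ^ 2 = x ^ 3 + b * x) :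
    (twoTorsionCurve 0 b).toAffine.Nonsingular x y := by
  have := twoTorsionCurve_zero_isElliptic hb
  exact equation_iff_nonsingular.mp (twoTorsionCurve_zero_equation_iff.mpr h)

theorem twoTorsionCurve_zero_negY (x y : ℚ) : (twoTorsionCurve 0 b).toAffine.negY x y = -y := by
  simp [negY, twoTorsionCurve]

theorem twoTorsionCurve_zero_addX (x y l : ℚ) :
    (twoTorsionCurve 0 b).toAffine.addX x y l = l ^ 2 - x - y := by
  simp [addX, twoTorsionCurve]

theorem twoTorsionCurve_zero_slope_self {x y : ℚ} (hy : y ≠ 0) :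
    (twoTorsionCurve 0 b).toAffine.slope x x y y = (3 * x ^ 2 + b) / (2 * y) := by
  have : y ≠ (twoTorsionCurve 0 b).toAffine.negY x y := by
    rw [twoTorsionCurve_zero_negY]; intro h; apply hy; linarith
  rw [slope_of_Y_ne rfl this, twoTorsionCurve_zero_negY]
  simp [twoTorsionCurve, two_mul]

/-- `addSubMap` sends `(x(P), x(Q))` to `(x(P + Q), x(P - Q))` on the symmetric square of `ℙ¹`. -/
theorem exists_addSubMap_eq_smul_sym2x (hb : b ≠ 0)
    (P Q : (twoTorsionCurve 0 b).toAffine.Point) :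
    ∃ c : ℚ, c ≠ 0 ∧ (fun i => (addSubMap (twoTorsionCurve 0 b) i).eval (P.sym2x Q)) =
      c • (P + Q).sym2x (P - Q) := by
  have hW := twoTorsionCurve_zero_isElliptic hb
  have key : ∀ s t u : ℚ, (fun i => (addSubMap (twoTorsionCurve 0 b) i).eval ![s, t, u]) =
      ![s ^ 2 - 2 * b * s * u + b ^ 2 * u ^ 2, 2 * t * s + 2 * b * t * u, t ^ 2 - 4 * s * u] := by
    intro s t u
    ext i
    fin_cases i <;> simp [addSubMap, b₂, b₄, b₆, b₈, twoTorsionCurve]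
  -- Doubling is treated apart; it also serves `Q = -P`, since negating `Q` only swaps `P + Q` and
  -- `P - Q`.
  have self : ∀ P : (twoTorsionCurve 0 b).toAffine.Point,
      ∃ c : ℚ, c ≠ 0 ∧ (fun i => (addSubMap (twoTorsionCurve 0 b) i).eval (P.sym2x P)) =
        c • (P + P).sym2x 0 := by
    rintro (_ | ⟨x, y, h⟩)
    · refine ⟨1, one_ne_zero, ?_⟩
      change _ = (1 : ℚ) • (0 + 0 : (twoTorsionCurve 0 b).toAffine.Point).sym2x 0
      rw [← Point.zero_def, add_zero, Point.sym2x_zero_zero, key]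
      simp
    · have he := twoTorsionCurve_zero_equation_iff.mp h.1
      by_cases hy : y = 0
      · subst hy
        rw [Point.add_self_of_Y_eq (by rw [twoTorsionCurve_zero_negY, neg_zero]), Point.sym2x_zero_zero,
          Point.sym2x_some_some, key]
        -- At a 2-torsion point the last two coordinates vanish, so the first cannot; it is the
        -- scalar sought.
        have h0 := addSubMap_ne_zero (twoTorsionCurve 0 b)
          (Point.sym2x_ne_zero (Point.some x 0 h) (Point.some x 0 h))
        rw [Point.sym2x_some_some, key] at h0
        have h1 : 2 * (x + x) * (x * x) + 2 * b * (x + x) * 1 = 0 := by linear_combination -4 * he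
        have h2 : (x + x) ^ 2 - 4 * (x * x) * 1 = 0 := by ring
        rw [h1, h2] at h0 ⊢
        refine ⟨(x * x) ^ 2 - 2 * b * (x * x) * 1 + b ^ 2 * 1 ^ 2, fun h3 => h0 ?_, by simp⟩
        rw [h3]; ext i; fin_cases i <;> rfl
      · have hy' : y ≠ (twoTorsionCurve 0 b).toAffine.negY x y := by
          rw [twoTorsionCurve_zero_negY]; intro h; apply hy; linarith
        rw [Point.add_self_of_Y_ne hy', Point.sym2x_some_zero, Point.sym2x_some_some, key,
          twoTorsionCurve_zero_addX, twoTorsionCurve_zero_slope_self hy]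
        refine ⟨4 * y ^ 2, by positivity, ?_⟩
        ext i
        fin_cases i
        · simp; field_simp; linear_combination (32 * x) * he
        · simp; linear_combination -4 * he
        · simp; ring
  rcases P with _ | ⟨x₁, y₁, h₁⟩
  · refine ⟨1, one_ne_zero, ?_⟩
    rw [← Point.zero_def, zero_add, zero_sub, Point.sym2x_neg_right]
    rcases Q with _ | ⟨x, y, h⟩
    · rw [← Point.zero_def, Point.sym2x_zero_zero, key]; simp
    · rw [Point.sym2x_zero_some, Point.sym2x_some_some, key]
      ext i; fin_cases i <;> simp <;> ring
  rcases Q with _ | ⟨x₂, y₂, h₂⟩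
  · refine ⟨1, one_ne_zero, ?_⟩
    rw [← Point.zero_def, add_zero, sub_zero, Point.sym2x_some_zero, Point.sym2x_some_some, key]
    ext i; fin_cases i <;> simp <;> ring
  by_cases hx : x₁ = x₂
  · rcases (Point.X_eq_iff (h₁ := h₁) (h₂ := h₂)).mp hx with h | h
    · rw [← h, sub_self]; exact self _
    · rw [eq_neg_iff_add_eq_zero, add_comm, ← eq_neg_iff_add_eq_zero] at h
      rw [h, Point.sym2x_neg_right, add_neg_cancel, sub_neg_eq_add, Point.sym2x_comm 0]
      exact self _
  · have e1 := twoTorsionCurve_zero_equation_iff.mp h₁.1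
    have e2 := twoTorsionCurve_zero_equation_iff.mp h₂.1
    have hd : x₁ - x₂ ≠ 0 := sub_ne_zero.mpr hx
    refine ⟨(x₁ - x₂) ^ 2, by positivity, ?_⟩
    rw [sub_eq_add_neg (Point.some x₁ y₁ h₁), Point.neg_some, Point.add_of_X_ne hx, Point.add_of_X_ne hx,
      Point.sym2x_some_some, Point.sym2x_some_some, key, twoTorsionCurve_zero_addX,
      twoTorsionCurve_zero_addX, slope_of_X_ne hx, slope_of_X_ne hx, twoTorsionCurve_zero_negY]
    ext i
    fin_cases i
    · simp; field_simp
      linear_combination (-(y₁ ^ 2 - y₂ ^ 2 + (x₁ ^ 3 + b * x₁) - (x₂ ^ 3 + b * x₂))) * (e1 - e2) +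
        2 * (x₁ + x₂) * (x₁ - x₂) ^ 2 * (e1 + e2)
    · simp; field_simp
      linear_combination (-2) * (e1 + e2)
    · simp; ring

/-- The naive height of a rational point. -/
noncomputable def pointHeight (P : (twoTorsionCurve 0 b).toAffine.Point) : ℝ :=
  logHeight P.xRep

/-- `addSubMap` is quadratic, so it doubles heights up to a constant, and the height of a symmetric
pair is the sum of the two heights up to a constant. -/
theorem pointHeight_parallelogram (hb : b ≠ 0) :
    ∃ C, ∀ P Q : (twoTorsionCurve 0 b).toAffine.Point,
      |pointHeight (P + Q) + pointHeight (P - Q) - 2 * (pointHeight P + pointHeight Q)| ≤ C := by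
  have hW := twoTorsionCurve_zero_isElliptic hb
  obtain ⟨C₁, h₁⟩ := abs_logHeight_addSubMap_sub_two_mul_logHeight_le (twoTorsionCurve 0 b)
  obtain ⟨C₂, h₂⟩ := abs_logHeight_sym2_sub_le ℚ
  have h₂' : ∀ P Q : (twoTorsionCurve 0 b).toAffine.Point,
      |logHeight (P.sym2x Q) - (pointHeight P + pointHeight Q)| ≤ C₂ := by
    intro P Q
    have e : ∀ P : (twoTorsionCurve 0 b).toAffine.Point, P.xRep = ![P.xRep 0, P.xRep 1] := by
      intro P; ext i; fin_cases i <;> rfl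
    have := @h₂ (P.xRep 0) (P.xRep 1) (Q.xRep 0) (Q.xRep 1) (e P ▸ P.xRep_ne_zero)
      (e Q ▸ Q.xRep_ne_zero)
    rwa [← e, ← e] at this
  refine ⟨C₁ + 3 * C₂, fun P Q => ?_⟩
  obtain ⟨c, hc, h⟩ := exists_addSubMap_eq_smul_sym2x hb P Q
  have h1 := h₁ (P.sym2x Q)
  rw [h, logHeight_smul_eq_logHeight _ hc] at h1
  have h2 := h₂' P Q
  have h3 := h₂' (P + Q) (P - Q)
  rw [abs_le] at *
  constructor <;> linarith [h1.1, h1.2, h2.1, h2.2, h3.1, h3.2]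

/-- Few `x` have bounded height, and each carries at most the two points `±P`. -/
instance pointHeight_northcott : Northcott (pointHeight (b := b)) where
  finite_le B := by
    have h := Northcott.finite_le (h := logHeight₁ (K := ℚ)) B
    refine Set.Finite.of_finite_fibers (fun P => P.xRep)
      ((h.image fun x => ![x, 1]).insert ![1, 0] |>.subset ?_) ?_
    · rintro _ ⟨P, hP, rfl⟩
      rcases P with _ | ⟨x, y, hxy⟩
      · exact Or.inl rfl
      · refine Or.inr ⟨x, ?_, rfl⟩
        simpa [pointHeight, logHeight₁_eq_logHeight] using hP
    · rintro _ ⟨P, hP, rfl⟩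
      refine (Set.toFinite {P, -P}).subset ?_
      rintro Q ⟨-, hQ⟩
      exact Point.eq_or_eq_neg_of_xRep_eq_xRep hQ

/-- Mordell's theorem, given the weak Mordell theorem. -/
theorem point_fg_of_finiteIndex (hb : b ≠ 0)
    (h : (nsmulAddMonoidHom (α := (twoTorsionCurve 0 b).toAffine.Point) 2).range.FiniteIndex) :
    AddGroup.FG (twoTorsionCurve 0 b).toAffine.Point := by
  obtain ⟨C, hC⟩ := pointHeight_parallelogram hb
  exact AddCommGroup.fg_of_descent' (h := pointHeight) h (fun _ => logHeight_nonneg _) hC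

end TwoTorsionCurve

/-! ### Arithmetic of square classes -/

section SquareClass

open WeierstrassCurve WeierstrassCurve.Affine

theorem squareClass_eq_iff {x y : ℚ} (hx : x ≠ 0) (hy : y ≠ 0) :
    squareClass x hx = squareClass y hy ↔ IsSquare (x * y) := by
  rw [squareClass, squareClass, QuotientGroup.eq]
  constructor
  · rintro ⟨u, hu⟩
    have h : (u : ℚ) ^ 2 = x⁻¹ * y := by simpa using congrArg Units.val hu
    refine ⟨u * x, ?_⟩
    field_simp at h
    linear_combination (-x) * h
  · rintro ⟨r, hr⟩
    have hr0 : r ≠ 0 := by rintro rfl; simp [hx, hy] at hr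
    refine ⟨Units.mk0 (r / x) (div_ne_zero hr0 hx), ?_⟩
    ext
    simp only [powMonoidHom_apply, Units.val_pow_eq_pow_val, Units.val_mk0, Units.val_mul,
      Units.val_inv_eq_inv_val]
    field_simp
    linear_combination -hr

theorem squareClass_mul {x y : ℚ} (hx : x ≠ 0) (hy : y ≠ 0) :
    squareClass (x * y) (mul_ne_zero hx hy) = squareClass x hx * squareClass y hy := by
  rw [squareClass, squareClass, squareClass, ← QuotientGroup.mk_mul]
  congr 1
  ext
  simp

theorem squareClass_one : squareClass 1 one_ne_zero = 1 := by
  rw [squareClass, Units.mk0_one]; rfl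

theorem squareClass_eq_one_iff {x : ℚ} (hx : x ≠ 0) : squareClass x hx = 1 ↔ IsSquare x := by
  rw [← squareClass_one, squareClass_eq_iff, mul_one]

theorem squareClass_mul_self {x : ℚ} (hx : x ≠ 0) : squareClass x hx * squareClass x hx = 1 := by
  rw [← squareClass_mul hx hx, squareClass_eq_one_iff]
  exact ⟨x, rfl⟩

theorem squareClass_eq_mul_iff {x y z : ℚ} (hx : x ≠ 0) (hy : y ≠ 0) (hz : z ≠ 0) :
    squareClass x hx = squareClass y hy * squareClass z hz ↔ IsSquare (x * (y * z)) := by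
  rw [← squareClass_mul hy hz, squareClass_eq_iff]

end SquareClass

/-! ### Descent homomorphism at a rational root, and halving of points -/

section RootDescent

open WeierstrassCurve WeierstrassCurve.Affine

variable {b e : ℚ}

/-- The descent map attached to a root `e` of the cubic `x³ + b x`. -/
def rootDescent (b e : ℚ) (hd : 3 * e ^ 2 + b ≠ 0) :
    (twoTorsionCurve 0 b).toAffine.Point → SquareClassGroup
  | .zero => 1
  | .some x _ _ => if hx : x = e then squareClass _ hd else squareClass (x - e) (sub_ne_zero.mpr hx)

theorem rootDescent_zero (hd : 3 * e ^ 2 + b ≠ 0) : rootDescent b e hd 0 = 1 := rfl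

theorem rootDescent_some_of_ne (hd : 3 * e ^ 2 + b ≠ 0) {x y : ℚ}
    (h : (twoTorsionCurve 0 b).toAffine.Nonsingular x y) (hx : x ≠ e) :
    rootDescent b e hd (.some x y h) = squareClass (x - e) (sub_ne_zero.mpr hx) :=
  dif_neg hx

theorem rootDescent_some_root (hd : 3 * e ^ 2 + b ≠ 0) {y : ℚ}
    (h : (twoTorsionCurve 0 b).toAffine.Nonsingular e y) :
    rootDescent b e hd (.some e y h) = squareClass _ hd :=
  dif_pos rfl

theorem rootDescent_neg (hd : 3 * e ^ 2 + b ≠ 0) (P : (twoTorsionCurve 0 b).toAffine.Point) :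
    rootDescent b e hd (-P) = rootDescent b e hd P := by
  rcases P with _ | ⟨x, y, h⟩ <;> rfl

theorem rootDescent_mul_self (hd : 3 * e ^ 2 + b ≠ 0)
    (P : (twoTorsionCurve 0 b).toAffine.Point) :
    rootDescent b e hd P * rootDescent b e hd P = 1 := by
  rcases P with _ | ⟨x, y, h⟩
  · exact one_mul 1
  · by_cases hx : x = e
    · subst hx; rw [rootDescent_some_root, squareClass_mul_self]
    · rw [rootDescent_some_of_ne _ _ hx, squareClass_mul_self]

/-- Translation by `(e, 0)` turns `x - e` into `(3e² + b)/(x - e)`. This dictates the value `3e² +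
b`, the derivative of the cubic, at the root itself. -/
theorem rootDescent_add_root (he : e ^ 3 + b * e = 0) (hd : 3 * e ^ 2 + b ≠ 0)
    {y : ℚ} (h : (twoTorsionCurve 0 b).toAffine.Nonsingular e y)
    (P : (twoTorsionCurve 0 b).toAffine.Point) :
    rootDescent b e hd (P + .some e y h) =
      rootDescent b e hd P * rootDescent b e hd (.some e y h) := by
  have hy : y = 0 := by
    have := twoTorsionCurve_zero_equation_iff.mp h.1
    rw [he] at this
    exact pow_eq_zero_iff two_ne_zero |>.mp this
  subst hy
  rcases P with _ | ⟨x₁, y₁, h₁⟩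
  · rw [← Point.zero_def, zero_add, rootDescent_zero, one_mul]
  have e1 := twoTorsionCurve_zero_equation_iff.mp h₁.1
  by_cases hx : x₁ = e
  · subst hx
    have hy : y₁ = 0 := by rw [he] at e1; exact pow_eq_zero_iff two_ne_zero |>.mp e1
    subst hy
    rw [rootDescent_mul_self, Point.add_self_of_Y_eq (by rw [twoTorsionCurve_zero_negY, neg_zero]),
      rootDescent_zero]
  · have hx' : x₁ - e ≠ 0 := sub_ne_zero.mpr hx
    have key : (y₁ / (x₁ - e)) ^ 2 - x₁ - e - e = (3 * e ^ 2 + b) / (x₁ - e) := by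
      field_simp
      linear_combination e1 + he
    have hne : (y₁ / (x₁ - e)) ^ 2 - x₁ - e ≠ e := by
      rw [← sub_ne_zero, key]
      exact div_ne_zero hd hx'
    simp only [Point.add_of_X_ne hx, twoTorsionCurve_zero_addX, slope_of_X_ne hx, sub_zero]
    rw [rootDescent_some_of_ne _ _ hne, rootDescent_some_of_ne _ _ hx, rootDescent_some_root,
      squareClass_eq_mul_iff, key]
    exact ⟨3 * e ^ 2 + b, by field_simp⟩

theorem rootDescent_add (he : e ^ 3 + b * e = 0) (hd : 3 * e ^ 2 + b ≠ 0)
    (P Q : (twoTorsionCurve 0 b).toAffine.Point) :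
    rootDescent b e hd (P + Q) = rootDescent b e hd P * rootDescent b e hd Q := by
  rcases P with _ | ⟨x₁, y₁, h₁⟩
  · rw [← Point.zero_def, zero_add, rootDescent_zero, one_mul]
  by_cases hx₁ : x₁ = e
  · subst hx₁; rw [add_comm, rootDescent_add_root he, mul_comm]
  rcases Q with _ | ⟨x₂, y₂, h₂⟩
  · rw [← Point.zero_def, add_zero, rootDescent_zero, mul_one]
  by_cases hx₂ : x₂ = e
  · subst hx₂; rw [rootDescent_add_root he]
  by_cases hxy : x₁ = x₂ ∧ y₁ = (twoTorsionCurve 0 b).toAffine.negY x₂ y₂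
  · rw [Point.add_of_Y_eq hxy.1 hxy.2, rootDescent_zero, rootDescent_some_of_ne _ _ hx₁,
      rootDescent_some_of_ne _ _ hx₂]
    obtain rfl := hxy.1
    rw [squareClass_mul_self]
  obtain ⟨x₃, y₃, h₃, hsum, hx₃⟩ : ∃ x₃ y₃, ∃ h₃ : (twoTorsionCurve 0 b).toAffine.Nonsingular x₃ y₃,
      Point.some x₁ y₁ h₁ + Point.some x₂ y₂ h₂ = Point.some x₃ y₃ h₃ ∧
      IsSquare ((x₃ - e) * ((x₁ - e) * (x₂ - e))) := by
    refine ⟨_, _, _, Point.add_some hxy, ?_⟩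
    -- The cubic minus the squared line through the points has roots `x₁, x₂, x₃`. At `e` the cubic
    -- vanishes, so the product of the `xᵢ - e` is the square of the line's value there.
    have h := congrArg (Polynomial.eval e) (addPolynomial_slope h₁.1 h₂.1 hxy)
    generalize (twoTorsionCurve 0 b).toAffine.slope x₁ x₂ y₁ y₂ = l at *
    rw [addPolynomial_eq] at h
    simp [Cubic.toPoly, twoTorsionCurve] at h
    refine ⟨l * (e - x₁) + y₁, ?_⟩
    rw [twoTorsionCurve_zero_addX]
    linear_combination -h - he
  rw [hsum]
  by_cases hx₃' : x₃ = e
  · subst hx₃'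
    -- When the sum lies over `e`, the second point is a translate of the negated first one by the
    -- sum.
    have h2 : Point.some x₂ y₂ h₂ = -Point.some x₁ y₁ h₁ + Point.some x₃ y₃ h₃ := by
      rw [← hsum]; abel
    rw [h2, rootDescent_add_root he, rootDescent_neg, ← mul_assoc, rootDescent_mul_self, one_mul]
  · rw [rootDescent_some_of_ne _ _ hx₁, rootDescent_some_of_ne _ _ hx₂,
      rootDescent_some_of_ne _ _ hx₃', squareClass_eq_mul_iff]
    exact hx₃

/-- The descent map attached to a root of the cubic, as a homomorphism. -/
def rootDescentHom (b e : ℚ) (he : e ^ 3 + b * e = 0) (hd : 3 * e ^ 2 + b ≠ 0) :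
    (twoTorsionCurve 0 b).toAffine.Point →+ Additive SquareClassGroup where
  toFun P := Additive.ofMul (rootDescent b e hd P)
  map_zero' := rfl
  map_add' P Q := by rw [rootDescent_add he, ofMul_mul]

/-- A point `(x, y)` such that all `x - eᵢ` are squares is twice another point. -/
theorem exists_add_self_eq {e₁ e₂ e₃ x y r₁ r₂ r₃ : ℚ} (hb : b ≠ 0)
    (h : (twoTorsionCurve 0 b).toAffine.Nonsingular x y)
    (hs : e₁ + e₂ + e₃ = 0) (hp : e₁ * e₂ + e₁ * e₃ + e₂ * e₃ = b) (hm : e₁ * e₂ * e₃ = 0)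
    (h₁₂ : e₁ ≠ e₂) (h₁₃ : e₁ ≠ e₃) (h₂₃ : e₂ ≠ e₃)
    (h₁ : x - e₁ = r₁ ^ 2) (h₂ : x - e₂ = r₂ ^ 2) (h₃ : x - e₃ = r₃ ^ 2)
    (hy : y = r₁ * r₂ * r₃) : ∃ Q, Q + Q = Point.some x y h := by
  have n₁₂ : r₁ + r₂ ≠ 0 := fun h0 => h₁₂ (by linear_combination h₂ - h₁ + (r₂ - r₁) * h0)
  have n₁₃ : r₁ + r₃ ≠ 0 := fun h0 => h₁₃ (by linear_combination h₃ - h₁ + (r₃ - r₁) * h0)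
  have n₂₃ : r₂ + r₃ ≠ 0 := fun h0 => h₂₃ (by linear_combination h₃ - h₂ + (r₃ - r₂) * h0)
  obtain rfl : e₁ = x - r₁ ^ 2 := by linear_combination -h₁
  obtain rfl : e₂ = x - r₂ ^ 2 := by linear_combination -h₂
  obtain rfl : e₃ = x - r₃ ^ 2 := by linear_combination -h₃
  obtain rfl : x = (r₁ ^ 2 + r₂ ^ 2 + r₃ ^ 2) / 3 := by linear_combination hs / 3
  subst hy
  have hQ0 : (r₁ + r₂) * (r₁ + r₃) * (r₂ + r₃) ≠ 0 := mul_ne_zero (mul_ne_zero n₁₂ n₁₃) n₂₃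
  -- Halving formula: `x' - eᵢ = (rᵢ + rⱼ)(rᵢ + rₖ)`, so the product of the three pairwise sums is a
  -- `y`-coordinate over `x'`.
  set x' := (r₁ ^ 2 + r₂ ^ 2 + r₃ ^ 2) / 3 + (r₁ * r₂ + r₁ * r₃ + r₂ * r₃) with hx'
  have hslope : (twoTorsionCurve 0 b).toAffine.slope x' x' ((r₁ + r₂) * (r₁ + r₃) * (r₂ + r₃))
      ((r₁ + r₂) * (r₁ + r₃) * (r₂ + r₃)) = r₁ + r₂ + r₃ := by
    rw [twoTorsionCurve_zero_slope_self hQ0, div_eq_iff (mul_ne_zero two_ne_zero hQ0), hx']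
    linear_combination -hp
  refine ⟨.some x' ((r₁ + r₂) * (r₁ + r₃) * (r₂ + r₃)) (twoTorsionCurve_zero_nonsingular hb ?_), ?_⟩
  · rw [hx']; linear_combination x' * hp - hm
  · have hne : (r₁ + r₂) * (r₁ + r₃) * (r₂ + r₃) ≠
        (twoTorsionCurve 0 b).toAffine.negY x' ((r₁ + r₂) * (r₁ + r₃) * (r₂ + r₃)) := by
      rw [twoTorsionCurve_zero_negY]; intro h; apply hQ0; linarith
    rw [Point.add_self_of_Y_ne hne, Point.some.injEq, hslope, twoTorsionCurve_zero_addX, addY,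
      negAddY, twoTorsionCurve_zero_negY, twoTorsionCurve_zero_addX]
    constructor <;> (rw [hx']; ring)

end RootDescent

/-! ### Square classes of `x`-coordinates divide the coefficient -/

section IntegralDescent

open WeierstrassCurve WeierstrassCurve.Affine

theorem Int.exists_sq_mul_squarefree {n : ℤ} (hn : n ≠ 0) :
    ∃ d s : ℤ, Squarefree d ∧ s ≠ 0 ∧ n = d * s ^ 2 := by
  obtain ⟨a, s, h, ha⟩ := Nat.sq_mul_squarefree n.natAbs
  have hs : s ≠ 0 := by rintro rfl; simp at h; exact hn (Int.natAbs_eq_zero.mp h.symm)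
  have h' : (|n| : ℤ) = a * (s : ℤ) ^ 2 := by
    rw [Int.abs_eq_natAbs, ← h]; push_cast; ring
  rcases abs_choice n with hc | hc
  · exact ⟨a, s, Int.squarefree_natCast.mpr ha, by exact_mod_cast hs, by rw [← h', hc]⟩
  · refine ⟨-a, s, by rw [← Int.squarefree_natAbs]; simpa using ha, by exact_mod_cast hs, ?_⟩
    linear_combination hc - h'

/-- The square class of the `x`-coordinate of a rational point of `y² = x³ + B x`, with `B`
an integer, is represented by a squarefree divisor of `B`. -/
theorem exists_squarefree_dvd_of_equation {x y : ℚ} {B : ℤ} (hx : x ≠ 0)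
    (h : y ^ 2 = x ^ 3 + B * x) : ∃ d : ℤ, Squarefree d ∧ d ∣ B ∧ IsSquare (x * d) := by
  have hv : (x.den : ℚ) ≠ 0 := by exact_mod_cast x.den_nz
  have hu : x.num ≠ 0 := Rat.num_ne_zero.mpr hx
  have hxe : x * x.den = x.num := Rat.mul_den_eq_num x
  have hcop : IsCoprime x.num (x.den : ℤ) := Rat.isCoprime_num_den x
  obtain ⟨c, hc⟩ : IsSquare ((x.num * x.den) * (x.num ^ 2 + B * x.den ^ 2)) := by
    rw [← Rat.isSquare_intCast_iff]
    refine ⟨y * x.den ^ 2, ?_⟩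
    push_cast
    rw [← hxe]
    linear_combination (-(x.den : ℚ) ^ 4) * h
  -- Here `d` is the squarefree part of numerator times denominator. It divides `num² + B den²`,
  -- hence is prime to `den`, hence divides `num` and finally `B`.
  obtain ⟨d, s, hd, hs, hds⟩ := Int.exists_sq_mul_squarefree
    (n := x.num * x.den) (mul_ne_zero hu (by exact_mod_cast x.den_nz))
  have hsc : s ∣ c := by
    rw [← Int.pow_dvd_pow_iff two_ne_zero, pow_two c, ← hc, hds]
    exact Dvd.dvd.mul_right (Dvd.intro_left _ rfl) _
  obtain ⟨c', rfl⟩ := hsc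
  have hc' : d * (x.num ^ 2 + B * x.den ^ 2) = c' ^ 2 := by
    apply mul_left_cancel₀ (pow_ne_zero 2 hs)
    rw [hds] at hc
    linear_combination hc
  have hdc : d ∣ c' := (hd.dvd_pow_iff_dvd two_ne_zero).mp (hc' ▸ Dvd.intro _ rfl)
  have hdK : d ∣ x.num ^ 2 + B * x.den ^ 2 := by
    have h2 : d * d ∣ d * (x.num ^ 2 + B * x.den ^ 2) := by
      rw [hc', pow_two]; exact mul_dvd_mul hdc hdc
    exact (mul_dvd_mul_iff_left hd.ne_zero).mp h2
  have hduv : d ∣ x.num * x.den := hds ▸ Dvd.intro _ rfl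
  have hdv : IsCoprime d (x.den : ℤ) := by
    have h1 : IsCoprime (x.num ^ 2 + B * x.den ^ 2) (x.den : ℤ) := by
      have := hcop.pow_left (m := 2)
      rw [pow_two (x.den : ℤ), ← mul_assoc]
      exact this.add_mul_right_left _
    exact h1.of_isCoprime_of_dvd_left hdK
  have hdu : d ∣ x.num := hdv.dvd_of_dvd_mul_right hduv
  refine ⟨d, hd, ?_, ?_⟩
  · refine (hdv.pow_right (n := 2)).dvd_of_dvd_mul_right ?_
    exact (dvd_add_right (dvd_pow hdu two_ne_zero)).mp hdK
  · have hds' : (x.num : ℚ) * x.den = d * s ^ 2 := by exact_mod_cast hds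
    refine ⟨d * s / x.den, ?_⟩
    field_simp
    linear_combination (d : ℚ) * hds' + (d : ℚ) * x.den * hxe

end IntegralDescent

/-! ### The two descent maps of `y² = x³ - p² x` -/

section CongruentCurve

open WeierstrassCurve WeierstrassCurve.Affine

variable {p : ℕ}

theorem squareClass_eq_of_isSquare_mul {x : ℚ} {d : ℤ} (hx : x ≠ 0) (hd : (d : ℚ) ≠ 0)
    (h : IsSquare (x * d)) : squareClass x hx = squareClass d hd :=
  (squareClass_eq_iff hx hd).mpr h

theorem squareClass_ne_of_mul_neg {x y : ℚ} (hx : x ≠ 0) (hy : y ≠ 0) (h : x * y < 0) :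
    squareClass x hx ≠ squareClass y hy := by
  rw [Ne, squareClass_eq_iff]
  exact fun hs => h.not_ge hs.nonneg

theorem not_isSquare_prime_cast (hp : p.Prime) : ¬ IsSquare (p : ℚ) := by
  rw [Rat.isSquare_natCast_iff]
  exact hp.prime.not_isSquare

theorem not_isSquare_two_mul_prime_cast (hp : p.Prime) (h2 : p ≠ 2) :
    ¬ IsSquare (2 * p : ℚ) := by
  have h : ((2 * p : ℕ) : ℚ) = 2 * p := by push_cast; rfl
  rw [← h, Rat.isSquare_natCast_iff]
  rintro ⟨c, hc⟩
  have hpc : p ∣ c := by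
    have : p ∣ c * c := hc ▸ Dvd.intro_left _ rfl
    exact (hp.dvd_mul.mp this).elim id id
  obtain ⟨k, rfl⟩ := hpc
  have h3 : 2 = p * (k * k) := by
    apply Nat.eq_of_mul_eq_mul_right hp.pos
    linarith
  have h4 : p ∣ 2 := Dvd.intro _ h3.symm
  exact h2 ((Nat.prime_dvd_prime_iff_eq hp Nat.prime_two).mp h4)

/-- The descent homomorphism of `y² = x³ - p² x` at `(0, 0)`. -/
noncomputable def descentHomZero (hp : p.Prime) :
    (twoTorsionCurve 0 (-(p : ℚ) ^ 2)).toAffine.Point →+ Additive SquareClassGroup :=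
  rootDescentHom _ 0 (by ring) (by
    have : (p : ℚ) ≠ 0 := Nat.cast_ne_zero.mpr hp.ne_zero
    simpa using this)

/-- The descent homomorphism of `y² = x³ - p² x` at `(-p, 0)`. -/
noncomputable def descentHomNeg (hp : p.Prime) :
    (twoTorsionCurve 0 (-(p : ℚ) ^ 2)).toAffine.Point →+ Additive SquareClassGroup :=
  rootDescentHom _ (-p) (by ring) (by
    have : (p : ℚ) ≠ 0 := Nat.cast_ne_zero.mpr hp.ne_zero
    have h : 3 * (-(p : ℚ)) ^ 2 + -(p : ℚ) ^ 2 = 2 * p ^ 2 := by ring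
    rw [h]; positivity)

theorem descentHomZero_some (hp : p.Prime) {x y : ℚ}
    (h : (twoTorsionCurve 0 (-(p : ℚ) ^ 2)).toAffine.Nonsingular x y) (hx : x ≠ 0) :
    descentHomZero hp (.some x y h) = Additive.ofMul (squareClass x hx) := by
  change Additive.ofMul (rootDescent _ _ _ _) = _
  rw [rootDescent_some_of_ne _ _ hx]
  simp only [sub_zero]

theorem descentHomZero_some_zero (hp : p.Prime) {y : ℚ}
    (h : (twoTorsionCurve 0 (-(p : ℚ) ^ 2)).toAffine.Nonsingular 0 y) :
    descentHomZero hp (.some 0 y h) =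
      Additive.ofMul (squareClass (-1) (neg_ne_zero.mpr one_ne_zero)) := by
  change Additive.ofMul (rootDescent _ _ _ _) = _
  rw [rootDescent_some_root]
  congr 1
  rw [squareClass_eq_iff]
  exact ⟨p, by ring⟩

theorem descentHomNeg_some (hp : p.Prime) {x y : ℚ}
    (h : (twoTorsionCurve 0 (-(p : ℚ) ^ 2)).toAffine.Nonsingular x y) (hx : x + p ≠ 0) :
    descentHomNeg hp (.some x y h) = Additive.ofMul (squareClass (x + p) hx) := by
  change Additive.ofMul (rootDescent _ _ _ _) = _
  rw [rootDescent_some_of_ne _ _ (fun h => hx (by rw [h]; ring))]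
  simp only [sub_neg_eq_add]

theorem descentHom_add_self {b e : ℚ} (he : e ^ 3 + b * e = 0) (hd : 3 * e ^ 2 + b ≠ 0)
    (P : (twoTorsionCurve 0 b).toAffine.Point) : rootDescentHom b e he hd (P + P) = 0 := by
  rw [map_add]
  exact congrArg Additive.ofMul (rootDescent_mul_self hd P)

/-- An affine point in the kernel of the descent map at `(0, 0)` has nonzero square
`x`-coordinate. -/
theorem exists_sq_of_mem_ker (hp : p.Prime) {x y : ℚ}
    {h : (twoTorsionCurve 0 (-(p : ℚ) ^ 2)).toAffine.Nonsingular x y}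
    (hP : descentHomZero hp (.some x y h) = 0) : ∃ r : ℚ, r ≠ 0 ∧ x = r ^ 2 := by
  by_cases hx : x = 0
  · subst hx
    rw [descentHomZero_some_zero, ofMul_eq_zero, squareClass_eq_one_iff] at hP
    have := hP.nonneg
    norm_num at this
  · rw [descentHomZero_some _ _ hx, ofMul_eq_zero, squareClass_eq_one_iff] at hP
    obtain ⟨r, rfl⟩ := hP
    exact ⟨r, fun h => hx (by rw [h, zero_mul]), (pow_two r).symm⟩

/-- If `x = r²` and `x + p = s²`, the curve equation makes `x - p` the square of `y/(r s)`, a root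
whose sign already matches `y`, so the point can be halved. -/
theorem ker_inf_ker_eq_range (hp : p.Prime) :
    (descentHomNeg hp).ker ⊓ (descentHomZero hp).ker = (nsmulAddMonoidHom
      (α := (twoTorsionCurve 0 (-(p : ℚ) ^ 2)).toAffine.Point) 2).range := by
  have hp0 : (0 : ℚ) < p := Nat.cast_pos.mpr hp.pos
  ext P
  simp only [AddSubgroup.mem_inf, AddMonoidHom.mem_ker, AddMonoidHom.mem_range,
    nsmulAddMonoidHom_apply, two_nsmul]
  constructor
  · rintro ⟨hP1, hP0⟩
    rcases P with _ | ⟨x, y, h⟩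
    · exact ⟨0, add_zero 0⟩
    obtain ⟨r, hr, rfl⟩ := exists_sq_of_mem_ker hp hP0
    have hxp : r ^ 2 + p ≠ 0 := by positivity
    rw [descentHomNeg_some _ _ hxp, ofMul_eq_zero, squareClass_eq_one_iff] at hP1
    obtain ⟨s, hs⟩ := hP1
    have hs0 : s ≠ 0 := by rintro rfl; simp [hxp] at hs
    have e1 := twoTorsionCurve_zero_equation_iff.mp h.1
    refine exists_add_self_eq (e₁ := 0) (e₂ := -p) (e₃ := p) (r₁ := r) (r₂ := s)
      (r₃ := y / (r * s)) (neg_ne_zero.mpr (by positivity)) h (by ring) (by ring) (by ring)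
      (by linarith) (by linarith) (by linarith) (by ring) (by rw [pow_two s, ← hs]; ring) ?_ ?_
    · rw [div_pow, e1, eq_div_iff (by positivity)]
      linear_combination (-(r ^ 2 - p) * r ^ 2) * hs
    · field_simp
  · rintro ⟨Q, rfl⟩
    exact ⟨descentHom_add_self _ _ Q, descentHom_add_self _ _ Q⟩

/-- Squarefree divisors of `p²` leave only `±1, ±p`, and the 2-torsion points already attain all
four. -/
theorem descentHomZero_range_card (hp : p.Prime) : Nat.card (descentHomZero hp).range = 4 := by
  have hp0 : (0 : ℚ) < p := Nat.cast_pos.mpr hp.pos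
  have hb : -(p : ℚ) ^ 2 ≠ 0 := neg_ne_zero.mpr (by positivity)
  rw [← SetLike.coe_sort_coe, Nat.card_coe_set_eq, Set.ncard_eq_four]
  refine ⟨.ofMul 1, .ofMul (squareClass (-1) (neg_ne_zero.mpr one_ne_zero)),
    .ofMul (squareClass p hp0.ne'), .ofMul (squareClass (-p) (neg_ne_zero.mpr hp0.ne')),
    ?_, ?_, ?_, ?_, ?_, ?_, ?_⟩
  · rw [← squareClass_one]
    exact squareClass_ne_of_mul_neg _ _ (by norm_num)
  · exact fun h => not_isSquare_prime_cast hp ((squareClass_eq_one_iff hp0.ne').mp h.symm)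
  · rw [← squareClass_one]
    exact squareClass_ne_of_mul_neg _ _ (by linarith)
  · exact squareClass_ne_of_mul_neg _ _ (by linarith)
  · intro h
    refine not_isSquare_prime_cast hp ?_
    have := (squareClass_eq_iff _ _).mp h
    simpa using this
  · exact squareClass_ne_of_mul_neg _ _ (by nlinarith)
  · ext c
    simp only [AddMonoidHom.coe_range, Set.mem_range, Set.mem_insert_iff, Set.mem_singleton_iff]
    constructor
    · rintro ⟨_ | ⟨x, y, h⟩, rfl⟩
      · exact Or.inl rfl
      by_cases hx : x = 0
      · subst hx
        rw [descentHomZero_some_zero]; simp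
      · rw [descentHomZero_some _ _ hx]
        have e1 := twoTorsionCurve_zero_equation_iff.mp h.1
        obtain ⟨d, hd, hdp, hs⟩ := exists_squarefree_dvd_of_equation (B := -(p : ℤ) ^ 2) hx
          (by push_cast; exact e1)
        have hdp' : d.natAbs ∣ p := by
          rw [← Int.natAbs_natCast p, Int.natAbs_dvd_natAbs]
          rw [dvd_neg] at hdp
          exact (hd.dvd_pow_iff_dvd two_ne_zero).mp hdp
        rw [squareClass_eq_of_isSquare_mul hx (Int.cast_ne_zero.mpr hd.ne_zero) hs]
        rcases (Nat.dvd_prime hp).mp hdp' with h1 | h1 <;>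
          rcases Int.natAbs_eq d with h2 | h2 <;> rw [h1] at h2 <;> subst h2 <;>
          simp [squareClass_one]
    · rintro (rfl | rfl | rfl | rfl)
      · exact ⟨0, rfl⟩
      · exact ⟨.some 0 0 (twoTorsionCurve_zero_nonsingular hb (by ring)),
          descentHomZero_some_zero _ _⟩
      · exact ⟨.some p 0 (twoTorsionCurve_zero_nonsingular hb (by ring)),
          descentHomZero_some _ _ _⟩
      · exact ⟨.some (-p) 0 (twoTorsionCurve_zero_nonsingular hb (by ring)),
          descentHomZero_some _ _ _⟩

theorem two_torsion_card (hp : p.Prime) : Nat.card (nsmulAddMonoidHom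
      (α := (twoTorsionCurve 0 (-(p : ℚ) ^ 2)).toAffine.Point) 2).ker = 4 := by
  have hp0 : (0 : ℚ) < p := Nat.cast_pos.mpr hp.pos
  have hb : -(p : ℚ) ^ 2 ≠ 0 := neg_ne_zero.mpr (by positivity)
  rw [← SetLike.coe_sort_coe, Nat.card_coe_set_eq, Set.ncard_eq_four]
  refine ⟨0, .some 0 0 (twoTorsionCurve_zero_nonsingular hb (by ring)),
    .some p 0 (twoTorsionCurve_zero_nonsingular hb (by ring)),
    .some (-p) 0 (twoTorsionCurve_zero_nonsingular hb (by ring)),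
    (Point.some_ne_zero _).symm, (Point.some_ne_zero _).symm, (Point.some_ne_zero _).symm,
    ?_, ?_, ?_, ?_⟩
  · rw [Ne, Point.some.injEq]; intro h; linarith [h.1]
  · rw [Ne, Point.some.injEq]; intro h; linarith [h.1]
  · rw [Ne, Point.some.injEq]; intro h; linarith [h.1]
  · ext P
    simp only [SetLike.mem_coe, AddMonoidHom.mem_ker, nsmulAddMonoidHom_apply, two_nsmul,
      Set.mem_insert_iff, Set.mem_singleton_iff]
    rcases P with _ | ⟨x, y, h⟩
    · simp only [← Point.zero_def, add_zero, true_or]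
    have e1 := twoTorsionCurve_zero_equation_iff.mp h.1
    simp only [Point.some_ne_zero, false_or, Point.some.injEq]
    constructor
    · intro hP
      have hy : y = 0 := by
        by_contra hy
        have hy' : y ≠ (twoTorsionCurve 0 (-(p : ℚ) ^ 2)).toAffine.negY x y := by
          rw [twoTorsionCurve_zero_negY]; intro h; apply hy; linarith
        rw [Point.add_self_of_Y_ne hy'] at hP
        exact Point.some_ne_zero _ hP
      subst hy
      have hx : x * ((x - p) * (x + p)) = 0 := by linear_combination -e1
      simp only [mul_eq_zero, sub_eq_zero, add_eq_zero_iff_eq_neg] at hx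
      simpa using hx
    · intro hx
      have hy : y = 0 := by tauto
      subst hy
      exact Point.add_self_of_Y_eq (by rw [twoTorsionCurve_zero_negY, neg_zero])

end CongruentCurve

/-! ### The isogenous curve and the rank formula -/

section IsogenousCurve

open WeierstrassCurve WeierstrassCurve.Affine

variable {p : ℕ}

theorem isogenousDescentMap_some (hp : p.Prime) {x y : ℚ}
    (h : (twoTorsionCurve 0 (4 * (p : ℚ) ^ 2)).toAffine.Nonsingular x y) (hx : x ≠ 0) :
    isogenousDescentMap p hp (.some x y h) = squareClass x hx :=
  dif_neg hx

theorem isogenousDescentMap_some_zero (hp : p.Prime) {y : ℚ}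
    (h : (twoTorsionCurve 0 (4 * (p : ℚ) ^ 2)).toAffine.Nonsingular 0 y) :
    isogenousDescentMap p hp (.some 0 y h) = 1 := by
  have h1 : isogenousDescentMap p hp (.some 0 y h) =
    squareClass _ (four_mul_sq_ne_zero_of_prime hp) := by
    simp [isogenousDescentMap, descentMap]
  rw [h1, squareClass_eq_one_iff]
  exact ⟨2 * p, by ring⟩

theorem isogenous_x_pos (hp : p.Prime) {x y : ℚ} (hx : x ≠ 0)
    (h : y ^ 2 = x ^ 3 + 4 * (p : ℚ) ^ 2 * x) : 0 < x := by
  have hp0 : (0 : ℚ) < p := Nat.cast_pos.mpr hp.pos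
  by_contra hneg
  have hx' : x < 0 := lt_of_le_of_ne (not_lt.mp hneg) hx
  have h1 : x * (x ^ 2 + 4 * (p : ℚ) ^ 2) < 0 := mul_neg_of_neg_of_pos hx' (by positivity)
  nlinarith [sq_nonneg y]

/-- The class of `c` is in the image of the descent map of the isogenous curve if and only if
it is represented by the `x`-coordinate of a point. -/
theorem mem_range_isogenousDescentMap_iff (hp : p.Prime) {c : ℚ} (hc : c ≠ 0)
    (hcs : ¬ IsSquare c) :
    squareClass c hc ∈ Set.range (isogenousDescentMap p hp) ↔
      ∃ x y : ℚ, x ≠ 0 ∧ y ^ 2 = x ^ 3 + 4 * (p : ℚ) ^ 2 * x ∧ IsSquare (x * c) := by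
  constructor
  · rintro ⟨_ | ⟨x, y, h⟩, hP⟩
    · exact absurd ((squareClass_eq_one_iff hc).mp hP.symm) hcs
    by_cases hx : x = 0
    · subst hx
      rw [isogenousDescentMap_some_zero] at hP
      exact absurd ((squareClass_eq_one_iff hc).mp hP.symm) hcs
    · rw [isogenousDescentMap_some _ _ hx, squareClass_eq_iff] at hP
      exact ⟨x, y, hx, twoTorsionCurve_zero_equation_iff.mp h.1, hP⟩
  · rintro ⟨x, y, hx, h, hs⟩
    refine ⟨.some x y (twoTorsionCurve_zero_nonsingular (four_mul_sq_ne_zero_of_prime hp) h), ?_⟩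
    rw [isogenousDescentMap_some _ _ hx, squareClass_eq_iff]
    exact hs

/-- The image of the descent map of the isogenous curve is the image under the descent map at
`(-p, 0)` of the kernel of the descent map at `(0, 0)`. -/
theorem range_isogenousDescentMap (hp : p.Prime) (c : SquareClassGroup) :
    c ∈ Set.range (isogenousDescentMap p hp) ↔
      Additive.ofMul c ∈ (descentHomZero hp).ker.map (descentHomNeg hp) := by
  have hp0 : (0 : ℚ) < p := Nat.cast_pos.mpr hp.pos
  have hb : -(p : ℚ) ^ 2 ≠ 0 := neg_ne_zero.mpr (by positivity)
  have hb' := four_mul_sq_ne_zero_of_prime hp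
  constructor
  · rintro ⟨_ | ⟨x, y, h⟩, rfl⟩
    · exact zero_mem _
    by_cases hx : x = 0
    · subst hx
      rw [isogenousDescentMap_some_zero]
      exact zero_mem _
    have e1 := twoTorsionCurve_zero_equation_iff.mp h.1
    have hxpos := isogenous_x_pos hp hx e1
    have hy : y ≠ 0 := by
      rintro rfl
      have : 0 < x ^ 3 + 4 * (p : ℚ) ^ 2 * x := by positivity
      linarith
    have hX : (y / (2 * x)) ^ 2 ≠ 0 := by positivity
    have hXp : (y / (2 * x)) ^ 2 + p ≠ 0 := by positivity
    have hXp' : (y / (2 * x)) ^ 2 + p = (x + 2 * p) ^ 2 / (4 * x) := by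
      field_simp; linear_combination 4 * e1
    -- The image of `(x, y)` under the 2-isogeny to `E`; its first coordinate plus `p` is `x` up to
    -- squares by `hXp'`.
    refine ⟨.some ((y / (2 * x)) ^ 2) (y * (4 * p ^ 2 - x ^ 2) / (8 * x ^ 2))
      (twoTorsionCurve_zero_nonsingular hb ?_), ?_, ?_⟩
    · have hX' : (y / (2 * x)) ^ 2 = (x ^ 2 + 4 * p ^ 2) / (4 * x) := by
        rw [div_pow, e1]; field_simp; ring
      rw [hX', div_pow, mul_pow, e1]
      field_simp
      ring
    · rw [SetLike.mem_coe, AddMonoidHom.mem_ker, descentHomZero_some _ _ hX, ofMul_eq_zero,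
        squareClass_eq_one_iff]
      exact ⟨_, pow_two _⟩
    · rw [descentHomNeg_some _ _ hXp, isogenousDescentMap_some _ _ hx]
      congr 1
      rw [squareClass_eq_iff, hXp']
      exact ⟨(x + 2 * p) / 2, by field_simp; ring⟩
  · rintro ⟨_ | ⟨x, y, h⟩, hP, hPc⟩
    · exact ⟨0, hPc⟩
    obtain ⟨r, hr, rfl⟩ := exists_sq_of_mem_ker hp hP
    have hxp : r ^ 2 + p ≠ 0 := by positivity
    rw [descentHomNeg_some _ _ hxp] at hPc
    have e1 := twoTorsionCurve_zero_equation_iff.mp h.1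
    have hw : (y / r) ^ 2 = r ^ 4 - p ^ 2 := by field_simp; linear_combination e1
    set w := y / r
    have hX : 2 * (r ^ 2 + w) ≠ 0 := by
      intro h0
      have : (p : ℚ) ^ 2 = 0 := by linear_combination (r ^ 2 - w) / 2 * h0 + hw
      exact hp0.ne' (pow_eq_zero_iff two_ne_zero |>.mp this)
    -- A preimage under the isogeny: `2(r² + w)` is a root of `x² - 4r²x + 4p² = 0`, which says that
    -- the image has first coordinate `r²`.
    refine ⟨.some (2 * (r ^ 2 + w)) (4 * r * (r ^ 2 + w))
      (twoTorsionCurve_zero_nonsingular hb' ?_), ?_⟩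
    · linear_combination (-8) * (r ^ 2 + w) * hw
    · rw [isogenousDescentMap_some _ _ hX]
      refine Eq.trans ?_ (congrArg Additive.toMul hPc)
      rw [toMul_ofMul, squareClass_eq_iff]
      exact ⟨r ^ 2 + p + w, by linear_combination -hw⟩

/-- The coefficient is `(2p)²`, so representatives are squarefree divisors of `2p`, positive since
`x > 0`. -/
theorem range_isogenousDescentMap_subset (hp : p.Prime) :
    Set.range (isogenousDescentMap p hp) ⊆
      {1, squareClass 2 two_ne_zero, squareClass p (Nat.cast_ne_zero.mpr hp.ne_zero),
        squareClass (2 * p) (mul_ne_zero two_ne_zero (Nat.cast_ne_zero.mpr hp.ne_zero))} := by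
  have hp0 : (0 : ℚ) < p := Nat.cast_pos.mpr hp.pos
  rintro _ ⟨_ | ⟨x, y, h⟩, rfl⟩
  · exact Or.inl rfl
  by_cases hx : x = 0
  · subst hx
    rw [isogenousDescentMap_some_zero]; exact Or.inl rfl
  have e1 := twoTorsionCurve_zero_equation_iff.mp h.1
  have hxpos := isogenous_x_pos hp hx e1
  rw [isogenousDescentMap_some _ _ hx]
  obtain ⟨d, hd, hdp, hs⟩ := exists_squarefree_dvd_of_equation (y := y) (B := (2 * p : ℤ) ^ 2) hx
    (by push_cast; linear_combination e1)
  have hdp' : d.natAbs ∣ 2 * p := by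
    have h1 := (hd.dvd_pow_iff_dvd two_ne_zero).mp hdp
    have h2 := Int.natAbs_dvd_natAbs.mpr h1
    simpa [Int.natAbs_mul] using h2
  have hd0 : 0 < d := by
    have h1 : 0 ≤ x * d := hs.nonneg
    have h2 : (0 : ℚ) ≤ d := nonneg_of_mul_nonneg_right h1 hxpos
    exact lt_of_le_of_ne (by exact_mod_cast h2) hd.ne_zero.symm
  lift d to ℕ using hd0.le
  rw [squareClass_eq_of_isSquare_mul hx (Int.cast_ne_zero.mpr hd.ne_zero) hs]
  obtain ⟨a, c, ha, hc, rfl⟩ := Nat.dvd_mul.mp hdp'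
  rcases (Nat.dvd_prime Nat.prime_two).mp ha with rfl | rfl <;>
    rcases (Nat.dvd_prime hp).mp hc with rfl | rfl <;> simp [squareClass_one]

theorem exists_rank_eq_and_card_range (hp : p.Prime) :
    ∃ r : ℕ, Module.rank ℤ (congruentCurve p).toAffine.Point = r ∧
      (Set.range (isogenousDescentMap p hp)).ncard = 2 ^ r := by
  have hp0 : (p : ℚ) ≠ 0 := Nat.cast_ne_zero.mpr hp.ne_zero
  have hb : -(p : ℚ) ^ 2 ≠ 0 := neg_ne_zero.mpr (pow_ne_zero 2 hp0)
  have hcard : (Set.range (isogenousDescentMap p hp)).ncard =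
      Nat.card ((descentHomZero hp).ker.map (descentHomNeg hp)) :=
    Nat.card_congr (Additive.ofMul.subtypeEquiv (range_isogenousDescentMap hp))
  have hfin : (Set.range (isogenousDescentMap p hp)).Finite :=
    (Set.toFinite _).subset (range_isogenousDescentMap_subset hp)
  have hpos : (Set.range (isogenousDescentMap p hp)).ncard ≠ 0 := by
    refine Set.ncard_ne_zero_of_mem (a := isogenousDescentMap p hp 0) ?_ hfin
    exact Set.mem_range_self 0
  -- Index of the intersection of the kernels: the image of one map on the other's kernel, times the
  -- image of the other.
  have hindex : (nsmulAddMonoidHom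
      (α := (twoTorsionCurve 0 (-(p : ℚ) ^ 2)).toAffine.Point) 2).range.index =
      (Set.range (isogenousDescentMap p hp)).ncard * 4 := by
    rw [← ker_inf_ker_eq_range hp, ← AddSubgroup.relIndex_mul_index inf_le_right,
      AddSubgroup.inf_relIndex_right, AddSubgroup.relIndex_ker, AddSubgroup.index_ker,
      descentHomZero_range_card, hcard]
  have hfg := point_fg_of_finiteIndex hb ⟨by rw [hindex]; exact mul_ne_zero hpos four_ne_zero⟩
  obtain ⟨r, hr, h⟩ := exists_rank_eq_and_nsmul_range_index
    (twoTorsionCurve 0 (-(p : ℚ) ^ 2)).toAffine.Point 2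
  refine ⟨r, hr, ?_⟩
  rw [hindex, two_torsion_card hp] at h
  exact Nat.eq_of_mul_eq_mul_right four_pos h

/-- For odd `p` the rank is two exactly when the classes of `p` and `2` are both in the image. -/
theorem rank_eq_two_iff (hp : p.Prime) (h2 : p ≠ 2) :
    Module.rank ℤ (congruentCurve p).toAffine.Point = 2 ↔
      squareClass (p : ℚ) (Nat.cast_ne_zero.mpr hp.ne_zero) ∈
        Set.range (isogenousDescentMap p hp) ∧
      squareClass 2 two_ne_zero ∈ Set.range (isogenousDescentMap p hp) := by
  have hp0 : (p : ℚ) ≠ 0 := Nat.cast_ne_zero.mpr hp.ne_zero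
  have hfour : ({1, squareClass 2 two_ne_zero, squareClass p hp0,
      squareClass (2 * p) (mul_ne_zero two_ne_zero hp0)} : Set SquareClassGroup).ncard = 4 := by
    have hsq2 : ¬ IsSquare (2 : ℚ) := by exact_mod_cast not_isSquare_prime_cast Nat.prime_two
    have hsqp := not_isSquare_prime_cast hp
    have hsq2p := not_isSquare_two_mul_prime_cast hp h2
    rw [Set.ncard_eq_four]
    refine ⟨_, _, _, _, ?_, ?_, ?_, ?_, ?_, ?_, rfl⟩
    · exact fun h => hsq2 ((squareClass_eq_one_iff _).mp h.symm)
    · exact fun h => hsqp ((squareClass_eq_one_iff _).mp h.symm)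
    · exact fun h => hsq2p ((squareClass_eq_one_iff _).mp h.symm)
    · rwa [Ne, squareClass_eq_iff]
    · rw [squareClass_mul two_ne_zero hp0, Ne, left_eq_mul, squareClass_eq_one_iff]
      exact hsqp
    · rw [squareClass_mul two_ne_zero hp0, Ne, right_eq_mul, squareClass_eq_one_iff]
      exact hsq2
  obtain ⟨r, hr, hcard⟩ := exists_rank_eq_and_card_range hp
  have hr2 : Module.rank ℤ (congruentCurve p).toAffine.Point = 2 ↔
      (Set.range (isogenousDescentMap p hp)).ncard = 4 := by
    rw [hr, hcard, show (4 : ℕ) = 2 ^ 2 from rfl, Nat.pow_right_inj one_lt_two]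
    norm_cast
  rw [hr2]
  have hsub := range_isogenousDescentMap_subset hp
  constructor
  · intro h4
    have heq := Set.eq_of_subset_of_ncard_le hsub (by rw [h4, hfour])
    rw [heq]
    simp
  · rintro ⟨h1, h2'⟩
    rw [← hfour]
    congr 1
    refine hsub.antisymm ?_
    rintro _ (rfl | rfl | rfl | rfl)
    · exact ⟨0, rfl⟩
    · exact h2'
    · exact h1
    · rw [range_isogenousDescentMap] at *
      rw [squareClass_mul two_ne_zero hp0, ofMul_mul]
      exact add_mem h2' h1

/-- The class of `2p = 4` is trivial, leaving at most two classes in the image. -/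
theorem rank_ne_two_of_eq_two (hp : Nat.Prime 2) :
    Module.rank ℤ (congruentCurve 2).toAffine.Point ≠ 2 := by
  obtain ⟨r, hr, hcard⟩ := exists_rank_eq_and_card_range hp
  have hsub : Set.range (isogenousDescentMap 2 hp) ⊆ {1, squareClass 2 two_ne_zero} := by
    refine (range_isogenousDescentMap_subset hp).trans ?_
    rintro _ (rfl | rfl | rfl | rfl)
    · simp
    · simp
    · simp
    · left
      rw [squareClass_eq_one_iff]
      exact ⟨2, by norm_num⟩
  have hle := (Set.ncard_le_ncard hsub).trans (Set.ncard_insert_le _ _)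
  rw [Set.ncard_singleton, hcard] at hle
  rw [hr]
  intro h
  obtain rfl : r = 2 := by exact_mod_cast h
  norm_num at hle

end IsogenousCurve

/-! ### Quartic equations and the Pythagorean conditions -/

section Pythagorean

variable {p : ℕ}

theorem Int.eq_zero_of_sq_eq_prime_mul_sq (hp : p.Prime) {u a : ℤ} (h : u ^ 2 = p * a ^ 2) :
    a = 0 := by
  by_contra ha
  refine not_isSquare_prime_cast hp ⟨u / a, ?_⟩
  have h' : (u : ℚ) ^ 2 = p * a ^ 2 := by exact_mod_cast h
  have ha' : (a : ℚ) ≠ 0 := Int.cast_ne_zero.mpr ha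
  field_simp
  linear_combination -h'

theorem Int.eq_zero_of_sq_eq_two_mul_sq {u a : ℤ} (h : u ^ 2 = 2 * a ^ 2) : a = 0 :=
  Int.eq_zero_of_sq_eq_prime_mul_sq Nat.prime_two (by exact_mod_cast h)

theorem isAlphaPythagorean_iff_minus (n : ℕ) :
    IsAlphaPythagorean n ↔ IsAlphaMinusPythagorean n := by
  refine ⟨?_, Or.inl⟩
  rintro (h | ⟨a, b, c, hg, h, hs⟩)
  · exact h
  · refine ⟨a, -b, c, by rwa [Int.neg_gcd], by rw [h]; ring, ?_⟩
    convert hs using 1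
    ring

theorem prime_mem_range_of_eq (hp : p.Prime) {M e N : ℤ} (hM : M ≠ 0) (he : e ≠ 0)
    (h : p * N ^ 2 = M ^ 4 + 4 * e ^ 4) :
    squareClass (p : ℚ) (Nat.cast_ne_zero.mpr hp.ne_zero) ∈
      Set.range (isogenousDescentMap p hp) := by
  have hp0 : (p : ℚ) ≠ 0 := Nat.cast_ne_zero.mpr hp.ne_zero
  rw [mem_range_isogenousDescentMap_iff hp hp0 (not_isSquare_prime_cast hp)]
  have hM' : (M : ℚ) ≠ 0 := Int.cast_ne_zero.mpr hM
  have he' : (e : ℚ) ≠ 0 := Int.cast_ne_zero.mpr he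
  have h' : (p : ℚ) * N ^ 2 = M ^ 4 + 4 * e ^ 4 := by exact_mod_cast h
  refine ⟨p * (M / e) ^ 2, p ^ 2 * M * N / e ^ 3, by positivity, ?_, p * (M / e), by ring⟩
  field_simp
  linear_combination h'

/-- With `x = p r²`, dividing `y²` by `(p r)²` leaves `p(r⁴ + 4)`. Writing `r = M/e` in lowest
terms, the integer `p(M⁴ + 4e⁴)` is a square divisible by `p`. -/
theorem prime_mem_range_iff (hp : p.Prime) :
    squareClass (p : ℚ) (Nat.cast_ne_zero.mpr hp.ne_zero) ∈ Set.range (isogenousDescentMap p hp) ↔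
      ∃ M e N : ℤ, IsCoprime M e ∧ M ≠ 0 ∧ e ≠ 0 ∧ p * N ^ 2 = M ^ 4 + 4 * e ^ 4 := by
  have hp0 : (p : ℚ) ≠ 0 := Nat.cast_ne_zero.mpr hp.ne_zero
  rw [mem_range_isogenousDescentMap_iff hp hp0 (not_isSquare_prime_cast hp)]
  constructor
  · rintro ⟨x, y, hx, h, t, ht⟩
    have ht0 : t ≠ 0 := by rintro rfl; simp [hx, hp0] at ht
    obtain ⟨r, hr⟩ : ∃ r : ℚ, r = t / p := ⟨_, rfl⟩
    have hr0 : r ≠ 0 := by rw [hr]; exact div_ne_zero ht0 hp0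
    have hxr : x = p * r ^ 2 := by rw [hr]; field_simp; linear_combination ht
    subst hxr
    have hrd : (r.den : ℚ) ≠ 0 := by exact_mod_cast r.den_nz
    have hre : r * r.den = r.num := Rat.mul_den_eq_num r
    obtain ⟨c, hc⟩ : IsSquare ((p : ℤ) * (r.num ^ 4 + 4 * r.den ^ 4)) := by
      rw [← Rat.isSquare_intCast_iff]
      refine ⟨y * r.den ^ 2 / (p * r), ?_⟩
      push_cast
      rw [← hre]
      field_simp
      linear_combination -h
    have hpc : (p : ℤ) ∣ c := by
      have h1 : (p : ℤ) ∣ c * c := hc ▸ Dvd.intro _ rfl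
      exact (Nat.prime_iff_prime_int.mp hp |>.dvd_or_dvd h1).elim id id
    obtain ⟨N, rfl⟩ := hpc
    refine ⟨r.num, r.den, N, Rat.isCoprime_num_den r, Rat.num_ne_zero.mpr hr0,
      by exact_mod_cast r.den_nz, ?_⟩
    apply mul_left_cancel₀ (show (p : ℤ) ≠ 0 by exact_mod_cast hp.ne_zero)
    linear_combination -hc
  · rintro ⟨M, e, N, -, hM, he, h⟩
    exact (mem_range_isogenousDescentMap_iff hp hp0 (not_isSquare_prime_cast hp)).mp
      (prime_mem_range_of_eq hp hM he h)

/-- With `x = 2 r²`, dividing `y²` by `(2 r)²` leaves `2(r⁴ + p²)`, which must be a square. -/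
theorem two_mem_range_iff (hp : p.Prime) :
    squareClass 2 two_ne_zero ∈ Set.range (isogenousDescentMap p hp) ↔
      ∃ M e N : ℤ, IsCoprime M e ∧ M ≠ 0 ∧ e ≠ 0 ∧ 2 * N ^ 2 = M ^ 4 + p ^ 2 * e ^ 4 := by
  have hsq2 : ¬ IsSquare (2 : ℚ) := by exact_mod_cast not_isSquare_prime_cast Nat.prime_two
  rw [mem_range_isogenousDescentMap_iff hp two_ne_zero hsq2]
  constructor
  · rintro ⟨x, y, hx, h, t, ht⟩
    have ht0 : t ≠ 0 := by rintro rfl; simp [hx] at ht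
    obtain ⟨r, hr⟩ : ∃ r : ℚ, r = t / 2 := ⟨_, rfl⟩
    have hr0 : r ≠ 0 := by rw [hr]; exact div_ne_zero ht0 two_ne_zero
    have hxr : x = 2 * r ^ 2 := by rw [hr]; linear_combination ht / 2
    subst hxr
    have hre : r * r.den = r.num := Rat.mul_den_eq_num r
    obtain ⟨c, hc⟩ : IsSquare (2 * (r.num ^ 4 + (p : ℤ) ^ 2 * r.den ^ 4)) := by
      rw [← Rat.isSquare_intCast_iff]
      refine ⟨y * r.den ^ 2 / (2 * r), ?_⟩
      push_cast
      rw [← hre]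
      field_simp
      linear_combination -h
    have hpc : 2 ∣ c := by
      have h1 : 2 ∣ c * c := hc ▸ Dvd.intro _ rfl
      exact (Int.prime_two.dvd_or_dvd h1).elim id id
    obtain ⟨N, rfl⟩ := hpc
    exact ⟨r.num, r.den, N, Rat.isCoprime_num_den r, Rat.num_ne_zero.mpr hr0,
      by exact_mod_cast r.den_nz, by linarith⟩
  · rintro ⟨M, e, N, -, hM, he, h⟩
    have hM' : (M : ℚ) ≠ 0 := Int.cast_ne_zero.mpr hM
    have he' : (e : ℚ) ≠ 0 := Int.cast_ne_zero.mpr he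
    have h' : 2 * (N : ℚ) ^ 2 = M ^ 4 + p ^ 2 * e ^ 4 := by exact_mod_cast h
    refine ⟨2 * (M / e) ^ 2, 4 * M * N / e ^ 3, by positivity, ?_, 2 * (M / e), by ring⟩
    field_simp
    linear_combination 8 * h'

theorem isBetaPythagorean_iff (hp : p.Prime) :
    IsBetaPythagorean p ↔
      squareClass 2 two_ne_zero ∈ Set.range (isogenousDescentMap p hp) := by
  rw [two_mem_range_iff]
  constructor
  · rintro ⟨a, e, m, u, h1, h2, hg⟩
    refine ⟨m, e, u, (Int.isCoprime_iff_gcd_eq_one.mpr hg).symm, ?_, ?_, ?_⟩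
    · rintro rfl
      have ha : a = 0 := Int.eq_zero_of_sq_eq_two_mul_sq (u := u) (by linarith)
      subst ha
      rw [Int.gcd_zero_right] at hg
      have he : e ^ 2 = 1 := by rw [← Int.natAbs_sq, hg]; rfl
      have : (p : ℤ) = 0 := by rw [he] at h2; linarith
      exact hp.ne_zero (by exact_mod_cast this)
    · rintro rfl
      rw [Int.gcd_zero_left] at hg
      have hm : m ^ 2 = 1 := by rw [← Int.natAbs_sq, hg]; rfl
      rw [hm] at h2
      omega
    · linear_combination 2 * h1 - (2 * a + p * e ^ 2 + m ^ 2) * h2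
  · rintro ⟨M, e, N, hcop, hM, he, h⟩
    -- Needed to define `a` by `2a = p e² + M²`; the square of the right side is even by the
    -- quartic.
    have heven : Even (p * e ^ 2 + M ^ 2 : ℤ) := by
      have h1 : Even ((p * e ^ 2 + M ^ 2 : ℤ) ^ 2) :=
        ⟨N ^ 2 + p * e ^ 2 * M ^ 2, by linear_combination -h⟩
      exact (Int.even_pow.mp h1).1
    obtain ⟨a, ha⟩ := heven
    refine ⟨a, e, M, N, ?_, by linear_combination ha, Int.isCoprime_iff_gcd_eq_one.mp hcop.symm⟩
    have h2 : 2 * ((p : ℤ) * e ^ 2 * M ^ 2) = 2 * (2 * a ^ 2 - N ^ 2) := by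
      linear_combination h + (p * e ^ 2 + M ^ 2 + 2 * a) * ha
    exact mul_left_cancel₀ two_ne_zero h2

/-- The equations force `m`, `u`, `a` and then `e` to be even, against coprimality. -/
theorem not_isBetaPythagorean_two : ¬ IsBetaPythagorean 2 := by
  rintro ⟨a, e, m, u, h1, h2, hg⟩
  push_cast at h1 h2
  obtain ⟨k, rfl⟩ : 2 ∣ m := by
    have : 2 ∣ m ^ 2 := ⟨a - e ^ 2, by linarith⟩
    exact Int.prime_two.dvd_of_dvd_pow this
  obtain ⟨v, rfl⟩ : 2 ∣ u := by
    have : 2 ∣ u ^ 2 := ⟨a ^ 2 - 4 * e ^ 2 * k ^ 2, by linarith⟩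
    exact Int.prime_two.dvd_of_dvd_pow this
  obtain ⟨a', rfl⟩ : 2 ∣ a := by
    have : 2 ∣ a ^ 2 := ⟨2 * e ^ 2 * k ^ 2 + v ^ 2, by linarith⟩
    exact Int.prime_two.dvd_of_dvd_pow this
  have he : 2 ∣ e := by
    have : 2 ∣ e ^ 2 := ⟨a' - k ^ 2, by linarith⟩
    exact Int.prime_two.dvd_of_dvd_pow this
  have h3 := Int.dvd_coe_gcd he (Dvd.intro k rfl)
  rw [hg] at h3
  norm_num at h3

/-- The factors of `M⁴ + 4e⁴` are coprime for odd `M`, as their difference is `4Me`. Once `p` is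
removed from the first, both are squares up to sign, and positivity fixes the sign; then `a = M +
e`, `b = e`. -/
theorem isAlphaMinusPythagorean_of_dvd (hp : p.Prime) {M e N : ℤ} (hcop : IsCoprime M e)
    (hM : Odd M) (h : p * N ^ 2 = M ^ 4 + 4 * e ^ 4) (hdvd : (p : ℤ) ∣ (M + e) ^ 2 + e ^ 2) :
    IsAlphaMinusPythagorean p := by
  have hp0 : (0 : ℤ) < p := by exact_mod_cast hp.pos
  have hM2 : IsCoprime M 2 := by
    obtain ⟨k, rfl⟩ := hM
    exact ⟨1, -k, by ring⟩
  have hA2 : IsCoprime ((M + e) ^ 2 + e ^ 2) 2 := by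
    have h1 : (M + e) ^ 2 + e ^ 2 = M ^ 2 + (M * e + e ^ 2) * 2 := by ring
    rw [h1]
    exact hM2.pow_left.add_mul_right_left _
  have hAM : IsCoprime ((M + e) ^ 2 + e ^ 2) M := by
    have h1 : (M + e) ^ 2 + e ^ 2 = 2 * e ^ 2 + (M + 2 * e) * M := by ring
    rw [h1]
    exact (hM2.symm.mul_left hcop.symm.pow_left).add_mul_right_left _
  have hAe : IsCoprime ((M + e) ^ 2 + e ^ 2) e := by
    have h1 : (M + e) ^ 2 + e ^ 2 = M ^ 2 + (2 * M + 2 * e) * e := by ring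
    rw [h1]
    exact hcop.pow_left.add_mul_right_left _
  have hAB : IsCoprime ((M + e) ^ 2 + e ^ 2) ((M - e) ^ 2 + e ^ 2) := by
    have h1 : (M - e) ^ 2 + e ^ 2 = -(2 * 2 * M * e) + 1 * ((M + e) ^ 2 + e ^ 2) := by ring
    rw [h1]
    exact (((hA2.mul_right hA2).mul_right hAM).mul_right hAe).neg_right.add_mul_right_right _
  obtain ⟨A, hA⟩ := hdvd
  have hprod : A * ((M - e) ^ 2 + e ^ 2) = N ^ 2 := by
    apply mul_left_cancel₀ hp0.ne'
    linear_combination (-((M - e) ^ 2 + e ^ 2)) * hA - h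
  have hcop' : IsCoprime A ((M - e) ^ 2 + e ^ 2) :=
    hAB.of_isCoprime_of_dvd_left (hA ▸ Dvd.intro_left _ rfl)
  have hM0 : M ≠ 0 := by rintro rfl; simp at hM
  have hBpos : 0 < (M - e) ^ 2 + e ^ 2 := by
    by_contra hneg
    have h1 : e = 0 := by nlinarith [sq_nonneg (M - e), sq_nonneg e]
    subst h1
    have : 0 < M ^ 2 := by positivity
    nlinarith
  have hA0 : 0 ≤ A := nonneg_of_mul_nonneg_left (hprod ▸ sq_nonneg N) hBpos
  obtain ⟨c, hc⟩ : ∃ c, A = c ^ 2 := by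
    obtain ⟨c, hc | hc⟩ := Int.sq_of_isCoprime hcop' hprod
    · exact ⟨c, hc⟩
    · exact ⟨0, by nlinarith [sq_nonneg c]⟩
  obtain ⟨d, hd⟩ : ∃ d, (M - e) ^ 2 + e ^ 2 = d ^ 2 := by
    obtain ⟨d, hd | hd⟩ := Int.sq_of_isCoprime hcop'.symm ((mul_comm _ _).trans hprod)
    · exact ⟨d, hd⟩
    · nlinarith [sq_nonneg d]
  refine ⟨M + e, e, c, ?_, by rw [hA, hc], d, by rw [← pow_two, ← hd]; ring⟩
  have hg : Int.gcd (M + e) e = 1 := by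
    rw [← Int.isCoprime_iff_gcd_eq_one]
    simpa using hcop.add_mul_right_left 1
  rw [← Int.gcd_assoc, hg]
  simp

theorem isAlphaPythagorean_iff (hp : p.Prime) :
    IsAlphaPythagorean p ↔ squareClass (p : ℚ) (Nat.cast_ne_zero.mpr hp.ne_zero) ∈
      Set.range (isogenousDescentMap p hp) := by
  rw [isAlphaPythagorean_iff_minus]
  constructor
  · rintro ⟨a, b, c, hg, h, d, hd⟩
    have hzero : b ≠ 0 := by
      rintro rfl
      have hc : c = 0 := Int.eq_zero_of_sq_eq_prime_mul_sq hp (u := a) (by linarith)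
      have ha : a = 0 := by
        subst hc
        exact (pow_eq_zero_iff two_ne_zero).mp (by linarith)
      subst hc ha
      simp at hg
    -- The substitution `M = a - b`, `e = b` turns the two factors into `a² + b² = p c²` and `(a -
    -- 2b)² + b² = d²`.
    refine prime_mem_range_of_eq hp (M := a - b) (e := b) (N := c * d) ?_ hzero ?_
    · intro hab
      obtain rfl : a = b := by linarith
      exact hzero (Int.eq_zero_of_sq_eq_two_mul_sq (u := d) (by linarith))
    · linear_combination d ^ 2 * h - (a ^ 2 + b ^ 2) * hd
  · rw [prime_mem_range_iff]
    rintro ⟨M, e, N, hcop, -, -, h⟩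
    obtain ⟨M, e, N, hcop, hM, h⟩ : ∃ M e N : ℤ, IsCoprime M e ∧ Odd M ∧
        p * N ^ 2 = M ^ 4 + 4 * e ^ 4 := by
      -- If `M = 2m`, then `e` is odd and `N = 2n`; dividing by `4` gives `p n² = e⁴ + 4m⁴`, with
      -- the roles exchanged.
      rcases Int.even_or_odd M with hM | hM
      · obtain ⟨m, rfl⟩ := hM.two_dvd
        have he : Odd e := by
          rw [← Int.not_even_iff_odd, even_iff_two_dvd]
          intro he
          have := hcop.isUnit_of_dvd' (Dvd.intro m rfl) he
          norm_num [Int.isUnit_iff] at this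
        have hN : Even N := by
          have h1 : Even ((p : ℤ) * N ^ 2) := ⟨8 * m ^ 4 + 2 * e ^ 4, by linear_combination h⟩
          rcases Int.even_mul.mp h1 with h2 | h2
          · have hp2 : p = 2 := by
              rcases hp.eq_two_or_odd' with h3 | h3
              · exact h3
              · exact absurd h2 (Int.not_even_iff_odd.mpr (by exact_mod_cast h3))
            subst hp2
            push_cast at h
            refine (Int.even_pow.mp (⟨4 * m ^ 4 + e ^ 4, by linarith⟩ : Even (N ^ 2))).1
          · exact (Int.even_pow.mp h2).1
        obtain ⟨n, rfl⟩ := hN.two_dvd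
        exact ⟨e, m, n, (hcop.of_isCoprime_of_dvd_left (Dvd.intro_left _ rfl)).symm, he,
          by linarith⟩
      · exact ⟨M, e, N, hcop, hM, h⟩
    -- The sign of `e` exchanges the two factors, so `p` may be taken to divide either.
    have hfac : (p : ℤ) ∣ ((M + e) ^ 2 + e ^ 2) * ((M + -e) ^ 2 + (-e) ^ 2) :=
      ⟨N ^ 2, by linear_combination -h⟩
    rcases (Nat.prime_iff_prime_int.mp hp).dvd_or_dvd hfac with h1 | h1
    · exact isAlphaMinusPythagorean_of_dvd hp hcop hM h h1
    · exact isAlphaMinusPythagorean_of_dvd hp hcop.neg_right hM (by rw [h]; ring) h1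

end Pythagorean

theorem mainTheorem1 (p : ℕ) (hp : p.Prime) :
    (Module.rank ℤ (congruentCurve p).toAffine.Point = 2 ↔
      IsAlphaPythagorean p ∧ IsBetaPythagorean p) ∧
    (IsAlphaPythagorean p ↔
      squareClass (p : ℚ) (Nat.cast_ne_zero.mpr hp.ne_zero) ∈
        Set.range (isogenousDescentMap p hp)) ∧
    (IsBetaPythagorean p ↔
      squareClass 2 two_ne_zero ∈ Set.range (isogenousDescentMap p hp)) := by
  refine ⟨?_, isAlphaPythagorean_iff hp, isBetaPythagorean_iff hp⟩
  by_cases h2 : p = 2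
  · subst h2
    exact iff_of_false (rank_ne_two_of_eq_two hp) fun h => not_isBetaPythagorean_two h.2
  · rw [isAlphaPythagorean_iff hp, isBetaPythagorean_iff hp]
    exact rank_eq_two_iff hp h2
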